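/- The series below converges absolutely, and $$\sum_{n=1}^{\infty} \frac{(28n^2-18n+3)(-64)^n}{n^5\binom{2n}{n}^4\binom{3n}{n}} = -14\,\zeta(3),$$ where $\zeta$ is the Riemann zeta function. -/

import Mathlib

/-!
The proof deforms the series by a real parameter `b` and uses a Wilf–Zeilberger pair in `(m, b)`,
where `n = m + 1` is the index of the series.  Up to a constant the deformed summand is
`4⁻ᵇ Γ(n)⁴ Γ(n+2b) Γ(b+1/2) (28n² + (20b-18)n + 3 - 6b)`
`  / (Γ(n+1/2) Γ(n+b+1/2)² Γ(3n) Γ(1+b-n))`,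
which is a rational function `wzG m b` of `b`.  It comes with a rational companion `wzF` such that
`wzG m (b + 1) - wzG m b = wzF (m + 1) b - wzF m b` (`wzG_add_one_sub`).  As
`wzF 0 b = -3 / (b + 1/2)²`, the sum `S b = ∑ₘ wzG m b` satisfies
`S (b + 1) = S b + 3 / (b + 1/2)²` (`tsum_wzG_add_one`).

The terms `wzG m b` are dominated by a geometric series uniformly in `b ≥ 0`, and each is a rational
function with a finite limit as `b → ∞`; hence `S` has a limit at infinity.  Comparing the
recurrence started at `b` with the one started at `0`, where every `wzG m 0` vanishes, gives
`S b = ∑ⱼ (3 / (j + 1/2)² - 3 / (b + j + 1/2)²)` (`tendsto_sum_tsum_wzG`).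

The factor `1 / Γ(1 + b - n)` makes `wzG m b` divisible by `b`.  The quotient `wzQuot m b` tends, as
`b → 0`, to `-3` times the summand of the theorem, so dividing by `b` and letting `b → 0⁺` under both
sums yields `-3 ∑ₙ (summand) = ∑ⱼ 6 / (j + 1/2)³ = 42 ζ(3)` (`tsum_wzQuot_zero`,
`hasSum_six_div_add_half_pow_three`).
-/

open Filter Topology Finset

/-! ### The Wilf–Zeilberger pair -/

/-- The part of the summand free of the deformation parameter: with `n = m + 1`, this is
`(n-1)!⁴ / ((1/2)ₙ (3n-1)!)`. -/
noncomputable def wzCoeff (m : ℕ) : ℝ :=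
  ∏ i ∈ range m, (((i : ℝ) + 1) ^ 4 /
    (((i : ℝ) + 3 / 2) * (3 * i + 3) * (3 * i + 4) * (3 * i + 5)))

/-- The part of the summand that is a product over `i < m`. With `n = m + 1` it collects
`(1+2b)ₙ₋₁ · b(b-1)⋯(b-n+2) / ((b+1/2)ₙ₋₁)²`; the last factors, `b - m` and `(b + 1/2 + m)²`, are
kept apart because `wzF` lacks the first of them. Each factor has absolute value at most `2` for
`b ≥ 0`. -/
noncomputable def wzProd (m : ℕ) (b : ℝ) : ℝ :=
  ∏ i ∈ range m, ((1 + 2 * b + i) * (b - i) / (b + 1 / 2 + i) ^ 2)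

/-- The quadratic polynomial factor of the deformed summand, in terms of `n = m + 1`. -/
noncomputable def wzPoly (m : ℕ) (b : ℝ) : ℝ :=
  28 * ((m : ℝ) + 1) ^ 2 + (20 * b - 18) * ((m : ℝ) + 1) + 3 - 6 * b

/-- The deformed summand, with index `n = m + 1`. -/
noncomputable def wzG (m : ℕ) (b : ℝ) : ℝ :=
  wzPoly m b * wzCoeff m * wzProd m b * (b - m) / (b + 1 / 2 + m) ^ 2

/-- The Wilf–Zeilberger companion of `wzG`. -/
noncomputable def wzF (m : ℕ) (b : ℝ) : ℝ :=
  -3 * (3 * m + 2) * (3 * m + 1) * (m + 1 / 2) * wzCoeff m * wzProd m b / (b + 1 / 2 + m) ^ 2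

/-- The quotient `wzG m b / b`, written without division by `b` so that it also makes sense at
`b = 0`; see `wzG_eq_mul_wzQuot`. -/
noncomputable def wzQuot (m : ℕ) (b : ℝ) : ℝ :=
  wzPoly m b * wzCoeff m *
    (∏ i ∈ range m, ((1 + 2 * b + i) * (b - (i + 1)) / (b + 1 / 2 + i) ^ 2)) /
      (b + 1 / 2 + m) ^ 2

theorem wzCoeff_succ (m : ℕ) : wzCoeff (m + 1) = wzCoeff m * (((m : ℝ) + 1) ^ 4 /
    (((m : ℝ) + 3 / 2) * (3 * m + 3) * (3 * m + 4) * (3 * m + 5))) :=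
  prod_range_succ _ _

theorem wzCoeff_succ_mul (m : ℕ) :
    (3 * (m : ℝ) + 5) * (3 * m + 4) * (m + 3 / 2) * wzCoeff (m + 1) =
      wzCoeff m * (m + 1) ^ 3 / 3 := by
  have h5 : (m : ℝ) + 3 / 2 ≠ 0 := by positivity
  have h6 : 3 * (m : ℝ) + 3 ≠ 0 := by positivity
  have h7 : 3 * (m : ℝ) + 4 ≠ 0 := by positivity
  have h8 : 3 * (m : ℝ) + 5 ≠ 0 := by positivity
  rw [wzCoeff_succ, ← mul_div_assoc, ← mul_div_assoc, div_eq_div_iff (by simp [*]) (by norm_num)]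
  ring

theorem wzProd_succ (m : ℕ) (b : ℝ) : wzProd (m + 1) b =
    wzProd m b * ((1 + 2 * b + m) * (b - m) / (b + 1 / 2 + m) ^ 2) :=
  prod_range_succ _ _

/-- The effect of `b ↦ b + 1` on the product. The factor `b + 1 - m` stays on the left: it vanishes
at `b = m - 1`, so it cannot be divided out. -/
theorem wzProd_add_one (m : ℕ) {b : ℝ} (hb : 0 ≤ b) :
    wzProd m (b + 1) * (b + 1 - m) =
      wzProd m b * ((1 + 2 * b + m) * (2 + 2 * b + m) * (b + 1 / 2) /
        (4 * (b + 1 / 2 + m) ^ 2)) := by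
  induction m with
  | zero =>
    have : b + 1 / 2 ≠ 0 := by positivity
    simp [wzProd]
    field_simp
    ring
  | succ m ih =>
    have h1 : b + 1 / 2 + m ≠ 0 := by positivity
    have h2 : b + 1 / 2 + (m + 1) ≠ 0 := by positivity
    have h3 : b + 1 + 1 / 2 + m ≠ 0 := by positivity
    have e : b + 1 + 1 / 2 + (m : ℝ) = b + 1 / 2 + (m + 1) := by ring
    rw [wzProd_succ, wzProd_succ]
    push_cast
    rw [e]
    calc _ = (wzProd m (b + 1) * (b + 1 - m)) *
          ((1 + 2 * (b + 1) + m) * (b - m) / (b + 1 / 2 + (m + 1)) ^ 2) := by ring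
      _ = _ := by
        rw [ih]
        field_simp
        ring

theorem wzG_add_one_sub (m : ℕ) {b : ℝ} (hb : 0 ≤ b) :
    wzG m (b + 1) - wzG m b = wzF (m + 1) b - wzF m b := by
  have h1 : b + 1 / 2 + m ≠ 0 := by positivity
  have h2 : b + 1 / 2 + (m + 1) ≠ 0 := by positivity
  have e : b + 1 + 1 / 2 + (m : ℝ) = b + 1 / 2 + (m + 1) := by ring
  have h4 : wzG m (b + 1) = wzPoly m (b + 1) * wzCoeff m *
      (wzProd m b * ((1 + 2 * b + m) * (2 + 2 * b + m) * (b + 1 / 2) /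
        (4 * (b + 1 / 2 + m) ^ 2))) / (b + 1 / 2 + (m + 1)) ^ 2 := by
    rw [← wzProd_add_one m hb, wzG, e]
    ring
  have h5 : wzF (m + 1) b = -3 * (wzCoeff m * (m + 1) ^ 3 / 3) *
      (wzProd m b * ((1 + 2 * b + m) * (b - m) / (b + 1 / 2 + m) ^ 2)) /
        (b + 1 / 2 + (m + 1)) ^ 2 := by
    rw [← wzCoeff_succ_mul, ← wzProd_succ, wzF]
    push_cast
    ring
  rw [h4, h5, wzG, wzF, wzPoly, wzPoly]
  clear h4 h5
  generalize wzCoeff m = u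
  generalize wzProd m b = w
  generalize (m : ℝ) = x at *
  -- In terms of `s = b + 1/2 + m` the denominators are the atoms `s` and `s + 1`.
  obtain ⟨s, rfl⟩ : ∃ s, b = s - 1 / 2 - x := ⟨b + 1 / 2 + x, by ring⟩
  rw [show s - 1 / 2 - x + 1 / 2 + x = s by ring] at *
  rw [show s - 1 / 2 - x + 1 / 2 + (x + 1) = s + 1 by ring] at *
  field_simp
  ring

/-! ### Uniform bounds and convergence -/

theorem wzCoeff_nonneg (m : ℕ) : 0 ≤ wzCoeff m :=
  prod_nonneg fun _ _ => by positivity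

theorem wzCoeff_le (m : ℕ) : wzCoeff m ≤ (1 / 27) ^ m := by
  have h : ∀ i ∈ range m, ((i : ℝ) + 1) ^ 4 /
      (((i : ℝ) + 3 / 2) * (3 * i + 3) * (3 * i + 4) * (3 * i + 5)) ≤ 1 / 27 := by
    intro i _
    rw [div_le_div_iff₀ (by positivity) (by norm_num)]
    have hi : (0 : ℝ) ≤ i := i.cast_nonneg
    have : 0 ≤ ((i : ℝ)) ^ 3 := by positivity
    nlinarith [sq_nonneg (i : ℝ)]
  exact (prod_le_prod (fun _ _ => by positivity) h).trans (by simp)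

theorem abs_wzProd_le (m : ℕ) {b : ℝ} (hb : 0 ≤ b) : |wzProd m b| ≤ 2 ^ m := by
  rw [wzProd, abs_prod]
  refine (prod_le_prod (fun _ _ => abs_nonneg _) (g := fun _ => (2 : ℝ)) ?_).trans (by simp)
  intro i _
  have hi : (0 : ℝ) ≤ i := i.cast_nonneg
  have hs : 0 < b + 1 / 2 + i := by positivity
  rw [abs_div, abs_mul, abs_of_pos (pow_pos hs 2), div_le_iff₀ (pow_pos hs 2), sq, ← mul_assoc]
  refine mul_le_mul ?_ ?_ (abs_nonneg _) (by positivity)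
  · rw [abs_of_nonneg (by positivity)]; linarith
  · rw [abs_le]; constructor <;> linarith

theorem add_one_mul_pow_le (m : ℕ) : ((m : ℝ) + 1) * (2 / 27) ^ m ≤ (4 / 27) ^ m := by
  have h : ((m : ℝ) + 1) ≤ 2 ^ m := by exact_mod_cast Nat.lt_two_pow_self (n := m)
  calc _ ≤ (2 : ℝ) ^ m * (2 / 27) ^ m := by gcongr
    _ = _ := by rw [← mul_pow]; norm_num

theorem abs_wzCoeff_mul_wzProd_le (m : ℕ) {b : ℝ} (hb : 0 ≤ b) :
    |wzCoeff m * wzProd m b| ≤ (2 / 27) ^ m := by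
  rw [abs_mul, abs_of_nonneg (wzCoeff_nonneg m)]
  calc _ ≤ (1 / 27 : ℝ) ^ m * 2 ^ m :=
        mul_le_mul (wzCoeff_le m) (abs_wzProd_le m hb) (abs_nonneg _) (by positivity)
    _ = _ := by rw [← mul_pow]; norm_num

theorem abs_wzG_le (m : ℕ) {b : ℝ} (hb : 0 ≤ b) : |wzG m b| ≤ 124 * (4 / 27) ^ m := by
  have hm : (0 : ℝ) ≤ m := m.cast_nonneg
  have hs : 0 < b + 1 / 2 + m := by positivity
  have h1 : |wzPoly m b| ≤ 124 * (m + 1) * (b + 1 / 2 + m) := by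
    rw [wzPoly, abs_le]
    constructor <;> nlinarith [mul_nonneg hb hm]
  have h2 : |b - m| ≤ b + 1 / 2 + m := by rw [abs_le]; constructor <;> linarith
  have h3 : |wzPoly m b * (b - m) / (b + 1 / 2 + m) ^ 2| ≤ 124 * ((m : ℝ) + 1) := by
    rw [abs_div, abs_mul, abs_of_pos (pow_pos hs 2), div_le_iff₀ (pow_pos hs 2), sq, ← mul_assoc]
    exact mul_le_mul h1 h2 (abs_nonneg _) (by positivity)
  calc |wzG m b| = |wzPoly m b * (b - m) / (b + 1 / 2 + m) ^ 2| * |wzCoeff m * wzProd m b| := by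
        rw [← abs_mul, wzG]; congr 1; ring
    _ ≤ (124 * (m + 1)) * (2 / 27) ^ m :=
        mul_le_mul h3 (abs_wzCoeff_mul_wzProd_le m hb) (abs_nonneg _) (by positivity)
    _ = 124 * ((m + 1) * (2 / 27) ^ m) := by ring
    _ ≤ _ := by gcongr; exact add_one_mul_pow_le m

theorem abs_wzF_le (m : ℕ) {b : ℝ} (hb : 0 ≤ b) : |wzF m b| ≤ 108 * (4 / 27) ^ m := by
  have hm : (0 : ℝ) ≤ m := m.cast_nonneg
  have hs : 0 < b + 1 / 2 + m := by positivity
  have h3 : |-3 * (3 * m + 2) * (3 * m + 1) * (m + 1 / 2) / (b + 1 / 2 + m) ^ 2| ≤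
      108 * ((m : ℝ) + 1) := by
    rw [abs_div, abs_of_pos (pow_pos hs 2), div_le_iff₀ (pow_pos hs 2), abs_of_nonpos (by
      have : 0 ≤ 3 * (3 * (m : ℝ) + 2) * (3 * m + 1) * (m + 1 / 2) := by positivity
      linarith)]
    have h4 : ((m : ℝ) + 1 / 2) ^ 2 ≤ (b + 1 / 2 + m) ^ 2 :=
      pow_le_pow_left₀ (by positivity) (by linarith) 2
    have h5 := mul_le_mul_of_nonneg_left h4 (by positivity : 0 ≤ 108 * ((m : ℝ) + 1))
    have : 0 ≤ (m : ℝ) ^ 3 := by positivity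
    nlinarith [sq_nonneg (m : ℝ)]
  calc |wzF m b| = |-3 * (3 * m + 2) * (3 * m + 1) * (m + 1 / 2) / (b + 1 / 2 + m) ^ 2| *
          |wzCoeff m * wzProd m b| := by
        rw [← abs_mul, wzF]; congr 1; ring
    _ ≤ (108 * (m + 1)) * (2 / 27) ^ m :=
        mul_le_mul h3 (abs_wzCoeff_mul_wzProd_le m hb) (abs_nonneg _) (by positivity)
    _ = 108 * ((m + 1) * (2 / 27) ^ m) := by ring
    _ ≤ _ := by gcongr; exact add_one_mul_pow_le m

theorem summable_const_mul_pow (C : ℝ) : Summable fun m : ℕ => C * (4 / 27 : ℝ) ^ m :=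
  (summable_geometric_of_lt_one (by norm_num) (by norm_num)).mul_left C

theorem summable_wzG {b : ℝ} (hb : 0 ≤ b) : Summable fun m => wzG m b :=
  .of_norm_bounded (summable_const_mul_pow 124) fun m => abs_wzG_le m hb

theorem wzF_zero (b : ℝ) : wzF 0 b = -3 / (b + 1 / 2) ^ 2 := by
  simp [wzF, wzCoeff, wzProd]

/-! ### Telescoping and the limit at infinity -/

theorem tsum_wzG_add_one {b : ℝ} (hb : 0 ≤ b) :
    ∑' m, wzG m (b + 1) = ∑' m, wzG m b + 3 / (b + 1 / 2) ^ 2 := by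
  have hF : Tendsto (fun m => wzF m b) atTop (𝓝 0) :=
    squeeze_zero_norm (fun m => abs_wzF_le m hb) (summable_const_mul_pow 108).tendsto_atTop_zero
  have hs := (summable_wzG (by positivity : 0 ≤ b + 1)).hasSum.sub (summable_wzG hb).hasSum
  have h2 : Tendsto (fun N => ∑ m ∈ range N, (wzG m (b + 1) - wzG m b)) atTop
      (𝓝 (0 - wzF 0 b)) := by
    simp_rw [wzG_add_one_sub _ hb, sum_range_sub (fun m => wzF m b)]
    exact hF.sub_const _
  have h3 := tendsto_nhds_unique hs.tendsto_sum_nat h2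
  rw [wzF_zero] at h3
  linear_combination h3

theorem tsum_wzG_add_natCast {b : ℝ} (hb : 0 ≤ b) (N : ℕ) :
    ∑' m, wzG m (b + N) = ∑' m, wzG m b + ∑ j ∈ range N, 3 / (b + j + 1 / 2) ^ 2 := by
  induction N with
  | zero => simp
  | succ N ih =>
    rw [sum_range_succ, ← add_assoc, ← ih, ← tsum_wzG_add_one (by positivity)]
    push_cast
    simp only [add_assoc]

theorem tendsto_linear_div_linear (p q r : ℝ) :
    Tendsto (fun b : ℝ => (p * b + q) / (b + r)) atTop (𝓝 p) := by
  have h : Tendsto (fun b : ℝ => p + (q - p * r) / (b + r)) atTop (𝓝 (p + 0)) :=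
    tendsto_const_nhds.add ((tendsto_atTop_add_const_right _ r tendsto_id).const_div_atTop _)
  rw [add_zero] at h
  refine h.congr' ?_
  filter_upwards [eventually_gt_atTop (-r)] with b hb
  have : b + r ≠ 0 := by linarith
  field_simp
  ring

theorem tendsto_wzProd (m : ℕ) : Tendsto (wzProd m) atTop (𝓝 (∏ _i ∈ range m, 2 * 1)) := by
  refine tendsto_finsetProd _ fun i _ => ?_
  have h := (tendsto_linear_div_linear 2 (1 + i) (1 / 2 + i)).mul
    (tendsto_linear_div_linear 1 (-i) (1 / 2 + i))
  refine h.congr fun b => ?_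
  rw [div_mul_div_comm, sq]
  congr 1 <;> ring

/-- The value of the limit is irrelevant: only its independence of the starting point of
`b, b + 1, b + 2, …` is used. -/
theorem exists_tendsto_wzG (m : ℕ) : ∃ l, Tendsto (wzG m) atTop (𝓝 l) := by
  have h := ((tendsto_linear_div_linear (20 * ((m : ℝ) + 1) - 6)
    (28 * ((m : ℝ) + 1) ^ 2 - 18 * ((m : ℝ) + 1) + 3) (1 / 2 + m)).mul
    (tendsto_linear_div_linear 1 (-m) (1 / 2 + m))).mul
    ((tendsto_wzProd m).const_mul (wzCoeff m))
  refine ⟨_, h.congr fun b => ?_⟩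
  rw [wzG, wzPoly, div_mul_div_comm, div_mul_eq_mul_div, sq (b + 1 / 2 + m)]
  congr 1 <;> ring

theorem exists_tendsto_tsum_wzG : ∃ L, Tendsto (fun b => ∑' m, wzG m b) atTop (𝓝 L) := by
  choose l hl using exists_tendsto_wzG
  refine ⟨∑' m, l m, tendsto_tsum_of_dominated_convergence (summable_const_mul_pow 124) hl ?_⟩
  filter_upwards [eventually_ge_atTop 0] with b hb m using abs_wzG_le m hb

theorem tsum_wzG_zero : ∑' m, wzG m 0 = 0 := by
  have h : ∀ m, wzG m 0 = 0 := by
    intro m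
    rcases m with _ | m
    · simp [wzG]
    · simp [wzG, wzProd, prod_range_succ']
  simp [h]

/-- `∑ₘ wzG m b` as a series over the shifts of `b`: the values at `b + N` and at `N` have the same
limit as `N → ∞`, and the sum at `0` is zero. -/
theorem tendsto_sum_tsum_wzG {b : ℝ} (hb : 0 ≤ b) :
    Tendsto (fun N => ∑ j ∈ range N,
      (3 / ((j : ℝ) + 1 / 2) ^ 2 - 3 / (b + j + 1 / 2) ^ 2)) atTop (𝓝 (∑' m, wzG m b)) := by
  obtain ⟨L, hL⟩ := exists_tendsto_tsum_wzG
  have hN : ∀ c : ℝ, Tendsto (fun N : ℕ => ∑' m, wzG m (c + N)) atTop (𝓝 L) := fun c =>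
    hL.comp (tendsto_atTop_add_const_left _ c tendsto_natCast_atTop_atTop)
  have h := ((hN 0).sub (hN b)).const_add (∑' m, wzG m b)
  rw [sub_self, add_zero] at h
  refine h.congr fun N => ?_
  rw [tsum_wzG_add_natCast hb, tsum_wzG_add_natCast le_rfl, tsum_wzG_zero, sum_sub_distrib]
  simp only [zero_add]
  ring

/-! ### Division by the parameter -/

theorem wzG_eq_mul_wzQuot (m : ℕ) (b : ℝ) : wzG m b = b * wzQuot m b := by
  have h : wzProd m b * (b - m) =
      b * ∏ i ∈ range m, ((1 + 2 * b + i) * (b - (i + 1)) / (b + 1 / 2 + i) ^ 2) := by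
    induction m with
    | zero => simp [wzProd]
    | succ m ih =>
      rw [wzProd_succ, prod_range_succ, ← mul_assoc b, ← ih]
      push_cast
      ring
  rw [wzG, wzQuot, mul_assoc (_ * _), h]
  ring

theorem abs_wzQuot_le (m : ℕ) {b : ℝ} (hb : 0 ≤ b) (hb1 : b ≤ 1) :
    |wzQuot m b| ≤ 196 * (4 / 27) ^ m := by
  have hm : (0 : ℝ) ≤ m := m.cast_nonneg
  have hs : 0 < b + 1 / 2 + m := by positivity
  have hb2 : 0 ≤ 1 - b := sub_nonneg.2 hb1
  have h1 : |wzPoly m b / (b + 1 / 2 + m) ^ 2| ≤ 196 := by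
    rw [abs_div, abs_of_pos (pow_pos hs 2), div_le_iff₀ (pow_pos hs 2), wzPoly, abs_le]
    constructor <;> nlinarith [mul_nonneg hb hm, mul_nonneg hb2 hm]
  have h2 : |∏ i ∈ range m, ((1 + 2 * b + i) * (b - (i + 1)) / (b + 1 / 2 + i) ^ 2)| ≤
      4 ^ m := by
    rw [abs_prod]
    refine (prod_le_prod (fun _ _ => abs_nonneg _) (g := fun _ => (4 : ℝ)) ?_).trans (by simp)
    intro i _
    have hi : (0 : ℝ) ≤ i := i.cast_nonneg
    have hs : 0 < b + 1 / 2 + i := by positivity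
    rw [abs_div, abs_mul, abs_of_pos (pow_pos hs 2), div_le_iff₀ (pow_pos hs 2),
      show 4 * (b + 1 / 2 + i) ^ 2 = 2 * (b + 1 / 2 + i) * (2 * (b + 1 / 2 + i)) by ring]
    refine mul_le_mul ?_ ?_ (abs_nonneg _) (by positivity)
    · rw [abs_of_nonneg (by positivity)]; linarith
    · rw [abs_le]; constructor <;> linarith
  rw [wzQuot, mul_assoc, mul_div_right_comm, abs_mul, abs_mul, abs_of_nonneg (wzCoeff_nonneg m)]
  refine mul_le_mul h1 ?_ (by have := wzCoeff_nonneg m; positivity) (by norm_num)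
  calc _ ≤ (1 / 27 : ℝ) ^ m * 4 ^ m :=
        mul_le_mul (wzCoeff_le m) h2 (abs_nonneg _) (by positivity)
    _ = _ := by rw [← mul_pow]; norm_num

theorem continuousAt_wzQuot (m : ℕ) : ContinuousAt (wzQuot m) 0 := by
  have h : ∀ i : ℕ, ((0 : ℝ) + 1 / 2 + i) ^ 2 ≠ 0 := fun i => by positivity
  unfold wzQuot wzPoly
  refine ContinuousAt.div ?_ (by fun_prop) (h m)
  refine ContinuousAt.mul (by fun_prop) ?_
  refine tendsto_finsetProd _ fun i _ => ?_
  exact ContinuousAt.div (f := fun b : ℝ => (1 + 2 * b + i) * (b - (i + 1))) (by fun_prop)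
    (by fun_prop) (h i)

/-- The odd-index part of the series for `ζ(3)`: `∑ 1 / (j + 1/2)³ = 8 (1 - 1/8) ζ(3)`. -/
theorem hasSum_six_div_add_half_pow_three :
    HasSum (fun j : ℕ => 6 / ((j : ℝ) + 1 / 2) ^ 3) (42 * ∑' n : ℕ, 1 / (n : ℝ) ^ 3) := by
  have hs : Summable fun n : ℕ => 1 / (n : ℝ) ^ 3 :=
    Real.summable_one_div_nat_pow.2 (by norm_num)
  have h := hs.hasSum
  set Z := ∑' n : ℕ, 1 / (n : ℝ) ^ 3
  have he : HasSum (fun k : ℕ => 1 / ((2 * k : ℕ) : ℝ) ^ 3) (1 / 8 * Z) := by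
    have e : (fun k : ℕ => 1 / ((2 * k : ℕ) : ℝ) ^ 3) = fun k : ℕ => 1 / 8 * (1 / (k : ℝ) ^ 3) := by
      funext k
      push_cast
      rw [mul_pow, div_mul_div_comm]
      norm_num
    rw [e]
    exact h.mul_left _
  have ho : Summable fun k : ℕ => 1 / ((2 * k + 1 : ℕ) : ℝ) ^ 3 :=
    hs.comp_injective (i := fun k : ℕ => 2 * k + 1) fun a b hab => by simpa using hab
  have hsum := (HasSum.even_add_odd (f := fun n : ℕ => 1 / (n : ℝ) ^ 3) he ho.hasSum).unique h
  have hZ : 42 * Z = 48 * ∑' k : ℕ, 1 / ((2 * k + 1 : ℕ) : ℝ) ^ 3 := by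
    linear_combination -48 * hsum
  have e : (fun j : ℕ => 6 / ((j : ℝ) + 1 / 2) ^ 3) =
      fun j : ℕ => 48 * (1 / ((2 * j + 1 : ℕ) : ℝ) ^ 3) := by
    funext j
    have : (2 * (j : ℝ) + 1) ≠ 0 := by positivity
    push_cast
    rw [show (j : ℝ) + 1 / 2 = (2 * j + 1) / 2 by ring]
    field_simp
    norm_num
  rw [hZ, e]
  exact ho.hasSum.mul_left 48

/-- The limit `b → 0⁺` of `tendsto_sum_tsum_wzG` after division by `b`, with dominated convergence
on both sides. -/
theorem tsum_wzQuot_zero : ∑' m, wzQuot m 0 = ∑' j : ℕ, 6 / ((j : ℝ) + 1 / 2) ^ 3 := by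
  have h1 : Tendsto (fun b => ∑' m, wzQuot m b) (𝓝[>] 0) (𝓝 (∑' m, wzQuot m 0)) := by
    refine tendsto_tsum_of_dominated_convergence (summable_const_mul_pow 196)
      (fun m => (continuousAt_wzQuot m).tendsto.mono_left nhdsWithin_le_nhds) ?_
    filter_upwards [Ioc_mem_nhdsGT (zero_lt_one' ℝ)] with b hb m
    exact abs_wzQuot_le m hb.1.le hb.2
  have hsum : Summable fun j : ℕ => 6 / ((j : ℝ) + 1 / 2) ^ 3 :=
    hasSum_six_div_add_half_pow_three.summable
  have hle : ∀ b : ℝ, 0 < b → ∀ j : ℕ,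
      |3 * (2 * ((j : ℝ) + 1 / 2) + b) / (((j : ℝ) + 1 / 2) ^ 2 * (b + j + 1 / 2) ^ 2)| ≤
        6 / ((j : ℝ) + 1 / 2) ^ 3 := by
    intro b hb j
    have hc : (0 : ℝ) < j + 1 / 2 := by positivity
    rw [abs_of_nonneg (by positivity), div_le_div_iff₀ (by positivity) (by positivity)]
    have e : b + j + 1 / 2 = b + (j + 1 / 2) := by ring
    rw [e]
    generalize (j : ℝ) + 1 / 2 = c at *
    have : 0 ≤ 3 * c ^ 2 * (b * c + 2 * b ^ 2) := by positivity
    nlinarith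
  have h2 : Tendsto (fun b : ℝ => ∑' j : ℕ,
      3 * (2 * ((j : ℝ) + 1 / 2) + b) / (((j : ℝ) + 1 / 2) ^ 2 * (b + j + 1 / 2) ^ 2)) (𝓝[>] 0)
      (𝓝 (∑' j : ℕ, 6 / ((j : ℝ) + 1 / 2) ^ 3)) := by
    refine tendsto_tsum_of_dominated_convergence hsum (fun j => ?_) ?_
    · have hc : ((j : ℝ) + 1 / 2) ≠ 0 := by positivity
      have : ContinuousAt (fun b : ℝ => 3 * (2 * ((j : ℝ) + 1 / 2) + b) /
          (((j : ℝ) + 1 / 2) ^ 2 * (b + j + 1 / 2) ^ 2)) 0 :=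
        ContinuousAt.div (by fun_prop) (by fun_prop) (by positivity)
      have h := this.tendsto.mono_left (nhdsWithin_le_nhds (s := Set.Ioi 0))
      convert h using 2
      rw [zero_add, add_zero]
      field_simp
      ring
    · filter_upwards [self_mem_nhdsWithin] with b hb j using hle b hb j
  refine tendsto_nhds_unique h1 (h2.congr' ?_)
  filter_upwards [self_mem_nhdsWithin] with b (hb : 0 < b)
  have hs : Summable fun j : ℕ =>
      3 * (2 * ((j : ℝ) + 1 / 2) + b) / (((j : ℝ) + 1 / 2) ^ 2 * (b + j + 1 / 2) ^ 2) :=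
    .of_norm_bounded hsum (hle b hb)
  have h3 := hs.hasSum.tendsto_sum_nat
  have h4 := (tendsto_sum_tsum_wzG hb.le).div_const b
  simp_rw [wzG_eq_mul_wzQuot, tsum_mul_left, sum_div] at h4
  rw [mul_div_cancel_left₀ _ hb.ne'] at h4
  refine tendsto_nhds_unique h3 (h4.congr fun N => sum_congr rfl fun j _ => ?_)
  have h5 : (j : ℝ) + 1 / 2 ≠ 0 := by positivity
  have h6 : b + j + 1 / 2 ≠ 0 := by positivity
  field_simp
  ring


/-! ### Identification of the summand -/

theorem wzCoeff_mul_prod_eq (m : ℕ) :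
    wzCoeff m * (∏ i ∈ range m, ((1 + 2 * (0 : ℝ) + i) * (0 - (i + 1)) / (0 + 1 / 2 + i) ^ 2)) /
        ((0 : ℝ) + 1 / 2 + m) ^ 2 =
      -3 * ((-64) ^ (m + 1) * ((m + 1).factorial : ℝ) ^ 9 / ((m + 1 : ℝ) ^ 5 *
        ((2 * (m + 1)).factorial : ℝ) ^ 3 * ((3 * (m + 1)).factorial : ℝ))) := by
  induction m with
  | zero => norm_num [wzCoeff, Nat.factorial]
  | succ m ih =>
    have f1 : ((m + 1 + 1).factorial : ℝ) = (m + 2) * (m + 1).factorial := by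
      rw [Nat.factorial_succ]; push_cast; ring
    have f2 : ((2 * (m + 1 + 1)).factorial : ℝ) =
        (2 * m + 4) * (2 * m + 3) * (2 * (m + 1)).factorial := by
      rw [show 2 * (m + 1 + 1) = 2 * (m + 1) + 1 + 1 by ring, Nat.factorial_succ,
        Nat.factorial_succ]
      push_cast; ring
    have f3 : ((3 * (m + 1 + 1)).factorial : ℝ) =
        (3 * m + 6) * (3 * m + 5) * (3 * m + 4) * (3 * (m + 1)).factorial := by
      rw [show 3 * (m + 1 + 1) = 3 * (m + 1) + 1 + 1 + 1 by ring, Nat.factorial_succ,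
        Nat.factorial_succ, Nat.factorial_succ]
      push_cast; ring
    have h1 : ((m + 1).factorial : ℝ) ≠ 0 := by positivity
    have h2 : ((2 * (m + 1)).factorial : ℝ) ≠ 0 := by positivity
    have h3 : ((3 * (m + 1)).factorial : ℝ) ≠ 0 := by positivity
    have h4 : (0 : ℝ) + 1 / 2 + m ≠ 0 := by positivity
    rw [div_eq_iff (pow_ne_zero 2 h4)] at ih
    rw [wzCoeff_succ, prod_range_succ, mul_mul_mul_comm, ih, f1, f2, f3, pow_succ (-64 : ℝ) (m + 1)]
    generalize (-64 : ℝ) ^ (m + 1) = q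
    generalize ((m + 1).factorial : ℝ) = x1 at *
    generalize ((2 * (m + 1)).factorial : ℝ) = x2 at *
    generalize ((3 * (m + 1)).factorial : ℝ) = x3 at *
    push_cast
    have hm : (0 : ℝ) ≤ m := m.cast_nonneg
    clear ih f1 f2 f3
    generalize (m : ℝ) = x at *
    have g1 : 2 * x + 1 ≠ 0 := by positivity
    have g2 : 2 * x + 3 ≠ 0 := by positivity
    have g3 : x + 1 ≠ 0 := by positivity
    have g4 : 3 * x + 4 ≠ 0 := by positivity
    have g5 : 3 * x + 5 ≠ 0 := by positivity
    have g6 : x + 2 ≠ 0 := by positivity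
    rw [show (0 : ℝ) + 1 / 2 + x = (2 * x + 1) / 2 by ring,
      show (0 : ℝ) + 1 / 2 + (x + 1) = (2 * x + 3) / 2 by ring,
      show x + 3 / 2 = (2 * x + 3) / 2 by ring, show 3 * x + 3 = 3 * (x + 1) by ring,
      show 2 * x + 4 = 2 * (x + 2) by ring, show 3 * x + 6 = 3 * (x + 2) by ring,
      show x + 1 + 1 = x + 2 by ring]
    field_simp
    ring

theorem summand_eq_wzQuot (m : ℕ) :
    ((28 * (m + 1 : ℝ) ^ 2 - 18 * (m + 1) + 3) * (-64) ^ (m + 1)) /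
      ((m + 1 : ℝ) ^ 5 * ((2 * (m + 1)).choose (m + 1) : ℝ) ^ 4 *
        ((3 * (m + 1)).choose (m + 1) : ℝ)) = -1 / 3 * wzQuot m 0 := by
  have c2 : ((2 * (m + 1)).choose (m + 1) : ℝ) =
      (2 * (m + 1)).factorial / ((m + 1).factorial * (m + 1).factorial) := by
    rw [two_mul, Nat.cast_add_choose]
  have c3 : ((3 * (m + 1)).choose (m + 1) : ℝ) =
      (3 * (m + 1)).factorial / ((m + 1).factorial * (2 * (m + 1)).factorial) := by
    rw [show 3 * (m + 1) = (m + 1) + 2 * (m + 1) by ring, Nat.cast_add_choose]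
  have h1 : ((m + 1).factorial : ℝ) ≠ 0 := by positivity
  have h2 : ((2 * (m + 1)).factorial : ℝ) ≠ 0 := by positivity
  have h3 : ((3 * (m + 1)).factorial : ℝ) ≠ 0 := by positivity
  have h4 : (m : ℝ) + 1 ≠ 0 := by positivity
  rw [wzQuot, mul_assoc (wzPoly m 0), mul_div_assoc (wzPoly m 0), wzCoeff_mul_prod_eq, wzPoly,
    c2, c3]
  field_simp
  ring

theorem hasSum_wzQuot_zero :
    HasSum (fun m => wzQuot m 0) (42 * ∑' n : ℕ, 1 / (n : ℝ) ^ 3) := by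
  have hs : Summable fun m => wzQuot m 0 :=
    .of_norm_bounded (summable_const_mul_pow 196) fun m => abs_wzQuot_le m le_rfl zero_le_one
  rw [← hasSum_six_div_add_half_pow_three.tsum_eq, ← tsum_wzQuot_zero]
  exact hs.hasSum

theorem mainTheorem2 :
    HasSum
      (fun n : ℕ+ =>
        ((28 * ((n : ℕ) : ℂ) ^ 2 - 18 * ((n : ℕ) : ℂ) + 3) * (-64 : ℂ) ^ (n : ℕ)) /
          (((n : ℕ) : ℂ) ^ 5 * (Nat.choose (2 * (n : ℕ)) (n : ℕ) : ℂ) ^ 4 *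
            (Nat.choose (3 * (n : ℕ)) (n : ℕ) : ℂ)))
      (-14 * riemannZeta 3) := by
  have hz : riemannZeta 3 = ((∑' n : ℕ, 1 / (n : ℝ) ^ 3 : ℝ) : ℂ) := by
    have h := zeta_nat_eq_tsum_of_gt_one (k := 3) (by norm_num)
    push_cast at h ⊢
    exact h
  rw [← Equiv.pnatEquivNat.symm.hasSum_iff, hz]
  convert Complex.hasSum_ofReal.2 (hasSum_wzQuot_zero.mul_left (-1 / 3)) using 1
  · funext m
    rw [← summand_eq_wzQuot]
    simp
  · push_cast
    ring
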